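/- Let $\ell, m \geq 0$ and let $(N^{\ell}, g^1)$ be a smooth Riemannian manifold of dimension $\ell$ that is Einstein with $\mathrm{Ric}_N = \frac12\, g^1$. Let $\Sigma = N \times \mathbf{R}^{m}$ (so $m = n-\ell$ for $n = \dim \Sigma$) with the product metric $\bar g = g^1 + g_{\mathbf{R}^m}$ and the potential $\bar f = \frac{|x|^2}{4} + \frac{\ell}{2}$, $x \in \mathbf{R}^m$. For a metric $g$ and a function $f$ set $\phi = \frac12\, g - \mathrm{Ric}_g - \mathrm{Hess}_f$, where $\mathrm{Hess}_f$ is computed with respect to $g$. Let $u$ be a $C^2$ function on $\Sigma$ that depends only on the factor $\mathbf{R}^m$, put $h = u\, g^1$ and $k = \frac{\ell}{2}\, u$, and let $\phi(t)$ be the tensor $\phi$ of the metric $\bar g + t\,h$ and the function $\bar f + t\,k$ (at each point of $\Sigma$ this is defined for all $t$ near $0$). Then at each point $\phi(t)$ is twice continuously differentiable in $t$ near $t=0$, and $$ 2\, \phi''(0) = -2\, |\nabla u|^2\, g^1 - 2\, \ell\, u\, \mathrm{Hess}_u - \ell\, du \otimes du , $$ where the gradient and the Hessian of $u$ on the right are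 taken with respect to $\bar g$. -/

import Mathlib

open scoped Manifold ContDiff Topology

set_option maxSynthPendingDepth 3

/-- The pullback `(v, w) ↦ B (A v) (A w)` of a bilinear form `B` under a linear map `A`. -/
noncomputable def bilinearPullback {V W : Type*} [AddCommGroup V] [Module ℝ V] [TopologicalSpace V]
    [AddCommGroup W] [Module ℝ W] [TopologicalSpace W]
    (B : W →L[ℝ] W →L[ℝ] ℝ) (A : V →L[ℝ] W) : V →L[ℝ] V →L[ℝ] ℝ :=
  (A.precomp ℝ).comp (B.comp A)

theorem bilinearPullback_apply {V W : Type*} [AddCommGroup V] [Module ℝ V] [TopologicalSpace V]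
    [AddCommGroup W] [Module ℝ W] [TopologicalSpace W]
    (B : W →L[ℝ] W →L[ℝ] ℝ) (A : V →L[ℝ] W) (v w : V) :
    bilinearPullback B A v w = B (A v) (A w) := rfl

/-! ## Riemannian geometry in an open subset of a vector space

`G y` is the metric at the point `y` and `E` is finite-dimensional. Everything below depends only
on `G` near the point `y`, and is meaningful where `G` is nondegenerate and twice differentiable. -/

namespace LocalGeometry

noncomputable section

variable {E : Type*} [NormedAddCommGroup E] [NormedSpace ℝ E]

/-- Twice the Christoffel symbols of the first kind: the trilinear form
`(v, w, z) ↦ (D_v G)(w, z) + (D_w G)(v, z) - (D_z G)(v, w)` at the point `y`. -/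
def koszul (G : E → E →L[ℝ] E →L[ℝ] ℝ) (y : E) : E →L[ℝ] E →L[ℝ] E →L[ℝ] ℝ :=
  fderiv ℝ G y + (fderiv ℝ G y).flip
    - ((ContinuousLinearMap.flipₗᵢ ℝ E E ℝ).toContinuousLinearEquiv :
        (E →L[ℝ] E →L[ℝ] ℝ) →L[ℝ] (E →L[ℝ] E →L[ℝ] ℝ)).comp (fderiv ℝ G y).flip

theorem koszul_apply (G : E → E →L[ℝ] E →L[ℝ] ℝ) (y v w z : E) :
    koszul G y v w z
      = fderiv ℝ G y v w z + fderiv ℝ G y w v z - fderiv ℝ G y z v w := rfl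

/-- The Christoffel symbols `Γ(v, w) = ∇_v w` (for constant vector fields `v, w`) of the
Levi-Civita connection of `G`. -/
def christoffel (G : E → E →L[ℝ] E →L[ℝ] ℝ) (y : E) : E →L[ℝ] E →L[ℝ] E :=
  (1 / 2 : ℝ) •
    (ContinuousLinearMap.compL ℝ E (E →L[ℝ] ℝ) E (G y).inverse).comp (koszul G y)

theorem christoffel_apply (G : E → E →L[ℝ] E →L[ℝ] ℝ) (y v w : E) :
    christoffel G y v w = (1 / 2 : ℝ) • (G y).inverse (koszul G y v w) := rfl

/-- The endomorphism `z ↦ ∇_z ∇_v w - ∇_v ∇_z w` (for constant vector fields `z, v, w`). -/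
def curvature (G : E → E →L[ℝ] E →L[ℝ] ℝ) (y v w : E) : E →L[ℝ] E :=
  ((fderiv ℝ (christoffel G) y).flip v).flip w - (fderiv ℝ (christoffel G) y v).flip w
    + (christoffel G y).flip (christoffel G y v w)
    - (christoffel G y v).comp ((christoffel G y).flip w)

theorem curvature_apply (G : E → E →L[ℝ] E →L[ℝ] ℝ) (y v w z : E) :
    curvature G y v w z
      = fderiv ℝ (christoffel G) y z v w - fderiv ℝ (christoffel G) y v z w
        + christoffel G y z (christoffel G y v w)
        - christoffel G y v (christoffel G y z w) := rfl

/-- The Ricci curvature `Ric(v, w)` is the trace of `z ↦ ∇_z ∇_v w - ∇_v ∇_z w`. With this sign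
the round spheres have positive Ricci curvature. -/
def ricci (G : E → E →L[ℝ] E →L[ℝ] ℝ) (y v w : E) : ℝ :=
  LinearMap.trace ℝ E (curvature G y v w : E →ₗ[ℝ] E)

/-- The Hessian `Hess_F(v, w) = D²F(v, w) - DF(Γ(v, w))`. -/
def hessian (G : E → E →L[ℝ] E →L[ℝ] ℝ) (F : E → ℝ) (y v w : E) : ℝ :=
  fderiv ℝ (fderiv ℝ F) y v w - fderiv ℝ F y (christoffel G y v w)

end

end LocalGeometry

/-! ## The same on a manifold without boundary

Christoffel symbols, Ricci curvature and Hessian at `q` are computed in the chart around `q`, and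
tangent vectors at `q` are transported to this chart by its derivative. Only the values of the
metric near `q` matter, so a field of bilinear forms that is positive definite near `q` suffices. -/

noncomputable section

/-- Fields of bilinear forms on the tangent spaces of a manifold. -/
abbrev BilinearField {E H : Type*} [NormedAddCommGroup E] [NormedSpace ℝ E] [TopologicalSpace H]
    (I : ModelWithCorners ℝ E H) (M : Type*) [TopologicalSpace M] [ChartedSpace H M] : Type _ :=
  ∀ q : M, TangentSpace I q →L[ℝ] TangentSpace I q →L[ℝ] ℝ

namespace BilinearField

variable {E H M : Type*} [NormedAddCommGroup E] [NormedSpace ℝ E] [TopologicalSpace H]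
  {I : ModelWithCorners ℝ E H} [TopologicalSpace M] [ChartedSpace H M]

/-- The expression of `g` in the chart around `q`: its pullback under the inverse of that chart. -/
def inChart (g : BilinearField I M) (q : M) (y : E) : E →L[ℝ] E →L[ℝ] ℝ :=
  bilinearPullback (V := TangentSpace 𝓘(ℝ, E) y) (g ((extChartAt I q).symm y))
    (mfderiv 𝓘(ℝ, E) I (extChartAt I q).symm y)

/-- The Ricci curvature of the metric `g`, computed in the chart around `q`. -/
def ricci (g : BilinearField I M) (q : M) (v w : TangentSpace I q) : ℝ :=
  LocalGeometry.ricci (g.inChart q) (extChartAt I q q)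
    (mfderiv I 𝓘(ℝ, E) (extChartAt I q) q v) (mfderiv I 𝓘(ℝ, E) (extChartAt I q) q w)

/-- The Hessian of the function `f` with respect to the metric `g`, computed in the chart
around `q`. -/
def hessian (g : BilinearField I M) (f : M → ℝ) (q : M) (v w : TangentSpace I q) : ℝ :=
  LocalGeometry.hessian (g.inChart q) (fun y => f ((extChartAt I q).symm y)) (extChartAt I q q)
    (mfderiv I 𝓘(ℝ, E) (extChartAt I q) q v) (mfderiv I 𝓘(ℝ, E) (extChartAt I q) q w)

/-- The tensor `φ = g / 2 - Ric_g - Hess_f`, which vanishes exactly when `(M, g, f)` is a gradient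
shrinking soliton. -/
def shrinkerDefect (g : BilinearField I M) (f : M → ℝ) (q : M) (v w : TangentSpace I q) : ℝ :=
  (1 / 2) * g q v w - g.ricci q v w - g.hessian f q v w

end BilinearField

/-! ## The product `N × ℝᵐ` -/

namespace ProductShrinker

variable {ℓ : ℕ} {N : Type*} [TopologicalSpace N] [ChartedSpace (EuclideanSpace ℝ (Fin ℓ)) N]

/-- The metric `g¹` of the first factor as a tensor on `N × ℝᵐ` (its pullback under the
projection to `N`). -/
def factorTensor (g₁ : BilinearField (𝓡 ℓ) N) (m : ℕ) :
    BilinearField ((𝓡 ℓ).prod (𝓡 m)) (N × EuclideanSpace ℝ (Fin m)) := fun q =>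
  bilinearPullback (g₁ q.1) (mfderiv ((𝓡 ℓ).prod (𝓡 m)) (𝓡 ℓ) Prod.fst q)

/-- The Euclidean metric of the second factor as a tensor on `N × ℝᵐ`. -/
def euclideanTensor (N : Type*) [TopologicalSpace N]
    [ChartedSpace (EuclideanSpace ℝ (Fin ℓ)) N] (m : ℕ) :
    BilinearField ((𝓡 ℓ).prod (𝓡 m)) (N × EuclideanSpace ℝ (Fin m)) := fun q =>
  bilinearPullback (innerSL ℝ : EuclideanSpace ℝ (Fin m) →L[ℝ] EuclideanSpace ℝ (Fin m) →L[ℝ] ℝ)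
    (mvfderiv ((𝓡 ℓ).prod (𝓡 m)) (fun q' : N × EuclideanSpace ℝ (Fin m) => q'.2) q)

/-- The product metric on `N × ℝᵐ`. -/
def metric (g₁ : BilinearField (𝓡 ℓ) N) (m : ℕ) :
    BilinearField ((𝓡 ℓ).prod (𝓡 m)) (N × EuclideanSpace ℝ (Fin m)) :=
  factorTensor g₁ m + euclideanTensor N m

/-- The potential `|x|² / 4 + ℓ / 2` on `N × ℝᵐ`. -/
def potential (ℓ : ℕ) (N : Type*) (m : ℕ) (q : N × EuclideanSpace ℝ (Fin m)) : ℝ :=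
  ‖q.2‖ ^ 2 / 4 + (ℓ : ℝ) / 2

/-- The tensor `φ(t)` of the metric `g + t h` and the potential `f + t k`, where `g` and `f` are the
metric and the potential of `N × ℝᵐ`. -/
def phi {m : ℕ} (g₁ : BilinearField (𝓡 ℓ) N)
    (h : BilinearField ((𝓡 ℓ).prod (𝓡 m)) (N × EuclideanSpace ℝ (Fin m)))
    (k : N × EuclideanSpace ℝ (Fin m) → ℝ) (t : ℝ) (q : N × EuclideanSpace ℝ (Fin m))
    (v w : TangentSpace ((𝓡 ℓ).prod (𝓡 m)) q) : ℝ :=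
  BilinearField.shrinkerDefect (metric g₁ m + t • h) (potential ℓ N m + t • k) q v w

end ProductShrinker

end

/-! Since `h` is a multiple of `g¹`, the deformed metric is again a warped product `a g¹ + g_{ℝᵐ}`
with `a = 1 + t u`. It is Riemannian where `a > 0`, hence at a given point for `t` near `0`. The
coefficient `a`, not its square root, is the convenient variable: it is affine in `t`, so its
derivatives are exactly `t` times those of `u`, and all other dependence on `t` comes from powers of
`1/a`.

The general formulas `ricci_warped` and `hessian_warped`, carried from charts to `N × ℝᵐ` by
`inChart_eq_warped`, therefore give `φ(t)` in closed form (`phi_eq`). The constant term vanishes by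
the Einstein condition on `N` and the Gaussian potential on `ℝᵐ`. What remains is a combination of
`t`, `t²`, `t/a`, `(t/a)²` and `t²/a`, whose second derivative at `0` is elementary.

The terms `-ℓ u Hess_u` and `-(ℓ/2) du ⊗ du` of `φ''(0)` come from the Ricci curvature. For `|∇u|²
g¹`, the Hessian of `t k` contributes `-ℓ/2` and the Ricci curvature `(ℓ-2)/2`; the sum is `-1`. -/

/-! ### Linear algebra: positive definite forms and block traces -/

theorem ContinuousLinearMap.isInvertible_of_forall_pos {E : Type*} [NormedAddCommGroup E]
    [NormedSpace ℝ E] [FiniteDimensional ℝ E] (b : E →L[ℝ] E →L[ℝ] ℝ)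
    (hb : ∀ v, v ≠ 0 → 0 < b v v) : b.IsInvertible := by
  have hinj : Function.Injective (b : E →ₗ[ℝ] E →L[ℝ] ℝ) := by
    rw [injective_iff_map_eq_zero]
    intro v hv
    by_contra h
    have h1 := hb v h
    have h2 : b v = 0 := hv
    simp [h2] at h1
  have hdim : Module.finrank ℝ E = Module.finrank ℝ (E →L[ℝ] ℝ) := by
    rw [← (LinearMap.toContinuousLinearMap (𝕜 := ℝ) (E := E) (F' := ℝ)).finrank_eq]
    exact (Subspace.dual_finrank_eq).symm
  exact ⟨(LinearEquiv.ofInjectiveOfFinrankEq (b : E →ₗ[ℝ] E →L[ℝ] ℝ) hinj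
    hdim).toContinuousLinearEquiv, by ext; rfl⟩

/-- Cyclicity of the trace moves the projections to the right, and the two composites then add up to
`T`. -/
theorem LinearMap.trace_eq_add_trace_prod {V W : Type*} [AddCommGroup V] [Module ℝ V]
    [FiniteDimensional ℝ V] [AddCommGroup W] [Module ℝ W] [FiniteDimensional ℝ W]
    (T : V × W →ₗ[ℝ] V × W) :
    LinearMap.trace ℝ (V × W) T
      = LinearMap.trace ℝ V (LinearMap.fst ℝ V W ∘ₗ T ∘ₗ LinearMap.inl ℝ V W)
        + LinearMap.trace ℝ W (LinearMap.snd ℝ V W ∘ₗ T ∘ₗ LinearMap.inr ℝ V W) := by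
  rw [← LinearMap.trace_comp_comm' (LinearMap.fst ℝ V W),
    ← LinearMap.trace_comp_comm' (LinearMap.snd ℝ V W),
    ← map_add]
  congr 1
  ext x <;> simp [← Prod.zero_eq_mk]

/-! ### Christoffel symbols in a vector space -/

namespace LocalGeometry

variable {E : Type*} [NormedAddCommGroup E] [NormedSpace ℝ E]

theorem apply_christoffel {G : E → E →L[ℝ] E →L[ℝ] ℝ} {y : E} (hG : (G y).IsInvertible)
    (v w z : E) : G y (christoffel G y v w) z = 1 / 2 * koszul G y v w z := by
  rw [christoffel_apply, map_smul, hG.self_apply_inverse]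
  rfl

/-- Nondegeneracy makes the Koszul identity characterize the connection, so a guessed formula can be
checked without inverting the metric. -/
theorem christoffel_eq {G : E → E →L[ℝ] E →L[ℝ] ℝ} {y : E} (hG : (G y).IsInvertible)
    {v w x : E} (h : ∀ z, G y x z = 1 / 2 * koszul G y v w z) : christoffel G y v w = x := by
  apply hG.injective
  ext z
  rw [apply_christoffel hG, h]

theorem differentiableAt_christoffel [CompleteSpace E] {G : E → E →L[ℝ] E →L[ℝ] ℝ} {y : E}
    (hd : ContDiffAt ℝ 2 G y) (hG : (G y).IsInvertible) :
    DifferentiableAt ℝ (christoffel G) y := by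
  have h1 : DifferentiableAt ℝ (fderiv ℝ G) y :=
    (hd.fderiv_right (m := 1) (by norm_num)).differentiableAt (by norm_num)
  have h2 : DifferentiableAt ℝ (fun y => (G y).inverse) y :=
    (hG.contDiffAt_map_inverse (n := 1)).differentiableAt (by norm_num) |>.comp y
      (hd.differentiableAt (by norm_num))
  have h3 : DifferentiableAt ℝ (fun y => (fderiv ℝ G y).flip) y :=
    (ContinuousLinearMap.flipₗᵢ ℝ E E (E →L[ℝ] ℝ)).toContinuousLinearEquiv.differentiableAt.comp
      y h1
  have h4 : DifferentiableAt ℝ (koszul G) y :=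
    (h1.add h3).sub ((differentiableAt_const _).clm_comp h3)
  have h5 : DifferentiableAt ℝ
      (fun y => ContinuousLinearMap.compL ℝ E (E →L[ℝ] ℝ) E (G y).inverse) y :=
    (ContinuousLinearMap.differentiableAt _).comp y h2
  exact (h5.clm_comp h4).const_smul (1 / 2 : ℝ)

theorem hasFDerivAt_apply_apply {V W X : Type*} [NormedAddCommGroup V] [NormedSpace ℝ V]
    [NormedAddCommGroup W] [NormedSpace ℝ W] [NormedAddCommGroup X] [NormedSpace ℝ X]
    {T : E → V →L[ℝ] W →L[ℝ] X} {y : E} (hT : DifferentiableAt ℝ T y) (a : V) (b : W) :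
    HasFDerivAt (fun x => T x a b) (((fderiv ℝ T y).flip a).flip b) y :=
  ((hT.hasFDerivAt.clm_apply (hasFDerivAt_const a y)).clm_apply
    (hasFDerivAt_const b y)).congr_fderiv (by ext; simp)

theorem fderiv_symm {G : E → E →L[ℝ] E →L[ℝ] ℝ} {y : E} (hd : DifferentiableAt ℝ G y)
    (hs : ∀ᶠ x in 𝓝 y, ∀ v w, G x v w = G x w v) (v w z : E) :
    fderiv ℝ G y v w z = fderiv ℝ G y v z w := by
  have key := hasFDerivAt_apply_apply hd
  have h1 := (key w z).congr_of_eventuallyEq (f₁ := fun x => G x z w) (by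
    filter_upwards [hs] with x hx using hx _ _)
  exact congrArg (fun L => L v) (h1.unique (key z w))

theorem christoffel_symm {G : E → E →L[ℝ] E →L[ℝ] ℝ} {y : E} (hd : DifferentiableAt ℝ G y)
    (hs : ∀ᶠ x in 𝓝 y, ∀ v w, G x v w = G x w v) (v w : E) :
    christoffel G y v w = christoffel G y w v := by
  rw [christoffel_apply, christoffel_apply]
  congr 2
  ext z
  rw [koszul_apply, koszul_apply, fderiv_symm hd hs z v w]
  ring

theorem _root_.Filter.EventuallyEq.christoffel {G G' : E → E →L[ℝ] E →L[ℝ] ℝ} {y : E}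
    (h : G =ᶠ[𝓝 y] G') : LocalGeometry.christoffel G =ᶠ[𝓝 y] LocalGeometry.christoffel G' := by
  filter_upwards [h.eventually_nhds] with x (hx : G =ᶠ[𝓝 x] G')
  have h1 : G x = G' x := hx.eq_of_nhds
  have h2 : fderiv ℝ G x = fderiv ℝ G' x := hx.fderiv_eq
  simp only [LocalGeometry.christoffel, koszul, h1, h2]

theorem ricci_congr {G G' : E → E →L[ℝ] E →L[ℝ] ℝ} {y : E} (h : G =ᶠ[𝓝 y] G') (v w : E) :
    ricci G y v w = ricci G' y v w := by
  have h1 := h.christoffel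
  simp only [ricci, curvature, h1.fderiv_eq, h1.eq_of_nhds]

theorem hessian_congr {G G' : E → E →L[ℝ] E →L[ℝ] ℝ} {F F' : E → ℝ} {y : E} (h : G =ᶠ[𝓝 y] G')
    (hF : F =ᶠ[𝓝 y] F') (v w : E) : hessian G F y v w = hessian G' F' y v w := by
  have h1 := h.christoffel
  simp only [hessian, h1.eq_of_nhds, hF.fderiv.fderiv_eq, hF.fderiv_eq]

end LocalGeometry

/-! ### Curvature and Hessian of a warped product -/

namespace LocalGeometry

variable {E₁ E₂ : Type*} [NormedAddCommGroup E₁] [NormedSpace ℝ E₁]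
  [NormedAddCommGroup E₂] [InnerProductSpace ℝ E₂]

/-- The warped product metric `a(y₂) B + ⟨·, ·⟩` on `E₁ × E₂`. -/
noncomputable def warped (B : E₁ → E₁ →L[ℝ] E₁ →L[ℝ] ℝ) (a : E₂ → ℝ) (y : E₁ × E₂) :
    E₁ × E₂ →L[ℝ] E₁ × E₂ →L[ℝ] ℝ :=
  bilinearPullback (a y.2 • B y.1) (ContinuousLinearMap.fst ℝ E₁ E₂)
    + bilinearPullback (innerSL ℝ : E₂ →L[ℝ] E₂ →L[ℝ] ℝ) (ContinuousLinearMap.snd ℝ E₁ E₂)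

theorem warped_apply (B : E₁ → E₁ →L[ℝ] E₁ →L[ℝ] ℝ) (a : E₂ → ℝ) (y v w : E₁ × E₂) :
    warped B a y v w = a y.2 * B y.1 v.1 w.1 + inner ℝ v.2 w.2 := rfl

variable {B : E₁ → E₁ →L[ℝ] E₁ →L[ℝ] ℝ} {a : E₂ → ℝ} {y : E₁ × E₂}

theorem contDiffAt_warped (hB : ContDiffAt ℝ 2 B y.1) (ha : ContDiffAt ℝ 2 a y.2) :
    ContDiffAt ℝ 2 (warped B a) y := by
  have h : ContDiffAt ℝ 2 (fun x : E₁ × E₂ => a x.2 • B x.1) y :=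
    (ha.comp y contDiffAt_snd).smul (hB.comp y contDiffAt_fst)
  exact (contDiffAt_const.clm_comp (h.clm_comp contDiffAt_const)).add contDiffAt_const

theorem fderiv_warped (hB : ContDiffAt ℝ 2 B y.1) (ha : ContDiffAt ℝ 2 a y.2) (v w z : E₁ × E₂) :
    fderiv ℝ (warped B a) y v w z
      = a y.2 * fderiv ℝ B y.1 v.1 w.1 z.1 + fderiv ℝ a y.2 v.2 * B y.1 w.1 z.1 := by
  have h1 := hasFDerivAt_apply_apply
    ((contDiffAt_warped hB ha).differentiableAt (by norm_num)) w z
  have h2 := (hasFDerivAt_apply_apply (hB.differentiableAt (by norm_num)) w.1 z.1).comp y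
    (hasFDerivAt_fst (𝕜 := ℝ) (p := y))
  have h3 := (ha.differentiableAt (by norm_num)).hasFDerivAt.comp y
    (hasFDerivAt_snd (𝕜 := ℝ) (p := y))
  have h4 := (h3.mul h2).add_const (inner ℝ w.2 z.2)
  have h5 := congrArg (fun L => L v) (h1.unique h4)
  simp only [ContinuousLinearMap.flip_apply] at h5
  rw [h5]
  simp [mul_comm]

variable [FiniteDimensional ℝ E₁] [FiniteDimensional ℝ E₂]

theorem isInvertible_warped (hB : ∀ v, v ≠ 0 → 0 < B y.1 v v) (ha : 0 < a y.2) :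
    (warped B a y).IsInvertible := by
  apply ContinuousLinearMap.isInvertible_of_forall_pos
  intro v hv
  rw [warped_apply]
  by_cases h : v.1 = 0
  · have h2 : v.2 ≠ 0 := fun h2 => hv (Prod.ext h h2)
    rw [h, map_zero, mul_zero, zero_add]
    exact real_inner_self_pos.2 h2
  · exact add_pos_of_pos_of_nonneg (mul_pos ha (hB _ h)) real_inner_self_nonneg

variable [CompleteSpace E₂]

theorem christoffel_warped (hB : ContDiffAt ℝ 2 B y.1) (hB' : ∀ v, v ≠ 0 → 0 < B y.1 v v)
    (ha : ContDiffAt ℝ 2 a y.2) (ha' : 0 < a y.2)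
    (v w : E₁ × E₂) :
    christoffel (warped B a) y v w
      = (christoffel B y.1 v.1 w.1
          + ((2 * a y.2)⁻¹ * fderiv ℝ a y.2 v.2) • w.1 + ((2 * a y.2)⁻¹ * fderiv ℝ a y.2 w.2) • v.1,
        (-(1 / 2) * B y.1 v.1 w.1) • gradient a y.2) := by
  apply christoffel_eq (isInvertible_warped hB' ha')
  intro z
  have hi : inner ℝ (gradient a y.2) z.2 = fderiv ℝ a y.2 z.2 := by
    rw [gradient, InnerProductSpace.toDual_symm_apply]
  have hc := apply_christoffel (ContinuousLinearMap.isInvertible_of_forall_pos _ hB') v.1 w.1 z.1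
  rw [koszul_apply] at hc
  rw [koszul_apply, warped_apply]
  simp only [fderiv_warped hB ha, map_add, map_smul, add_apply,
    smul_apply, smul_eq_mul, inner_smul_left, hi, hc]
  rw [conj_trivial]
  field_simp
  ring

theorem fderiv_christoffel_warped (hB : ContDiffAt ℝ 2 B y.1)
    (hB' : ∀ᶠ x in 𝓝 y.1, ∀ v, v ≠ 0 → 0 < B x v v)
    (ha : ContDiffAt ℝ 2 a y.2) (ha' : 0 < a y.2)
    (v w z : E₁ × E₂) :
    fderiv ℝ (christoffel (warped B a)) y z v w
      = (fderiv ℝ (christoffel B) y.1 z.1 v.1 w.1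
          + ((2 * a y.2)⁻¹ * fderiv ℝ (fderiv ℝ a) y.2 z.2 v.2
              - 2⁻¹ * (a y.2 ^ 2)⁻¹ * fderiv ℝ a y.2 z.2 * fderiv ℝ a y.2 v.2) • w.1
          + ((2 * a y.2)⁻¹ * fderiv ℝ (fderiv ℝ a) y.2 z.2 w.2
              - 2⁻¹ * (a y.2 ^ 2)⁻¹ * fderiv ℝ a y.2 z.2 * fderiv ℝ a y.2 w.2) • v.1,
        (-(1 / 2) * B y.1 v.1 w.1) • fderiv ℝ (gradient a) y.2 z.2
          + (-(1 / 2) * fderiv ℝ B y.1 z.1 v.1 w.1) • gradient a y.2) := by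
  have hBi : (B y.1).IsInvertible :=
    ContinuousLinearMap.isInvertible_of_forall_pos _ hB'.self_of_nhds
  have h1 := hasFDerivAt_apply_apply (differentiableAt_christoffel (contDiffAt_warped hB ha)
    (isInvertible_warped hB'.self_of_nhds ha')) v w
  -- The hypotheses persist near `y`, so the explicit Christoffel formula may be differentiated
  -- there.
  have hev : (fun x => christoffel (warped B a) x v w) =ᶠ[𝓝 y] fun x =>
      (christoffel B x.1 v.1 w.1
          + ((2 * a x.2)⁻¹ * fderiv ℝ a x.2 v.2) • w.1 + ((2 * a x.2)⁻¹ * fderiv ℝ a x.2 w.2) • v.1,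
        (-(1 / 2) * B x.1 v.1 w.1) • gradient a x.2) := by
    have hf : Filter.Tendsto Prod.fst (𝓝 y) (𝓝 y.1) := continuous_fst.continuousAt
    have hg : Filter.Tendsto Prod.snd (𝓝 y) (𝓝 y.2) := continuous_snd.continuousAt
    filter_upwards [hf.eventually (hB.eventually (by norm_num)),
      hf.eventually hB', hg.eventually (ha.eventually (by norm_num)),
      hg.eventually (ha.continuousAt.eventually_const_lt ha')] with x h1 h2 h3 h4
    exact christoffel_warped h1 h2 h3 h4 v w
  have hfst := hasFDerivAt_fst (𝕜 := ℝ) (p := y)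
  have hsnd := hasFDerivAt_snd (𝕜 := ℝ) (p := y)
  have hda : DifferentiableAt ℝ (fderiv ℝ a) y.2 :=
    (ha.fderiv_right (m := 1) (by norm_num)).differentiableAt (by norm_num)
  have hinv : HasFDerivAt (fun x : E₂ => (2 * a x)⁻¹) _ y.2 :=
    (hasDerivAt_inv (by positivity : 2 * a y.2 ≠ 0)).comp_hasFDerivAt (f := fun x => 2 * a x) y.2
      (((ha.differentiableAt (by norm_num)).hasFDerivAt).const_mul 2)
  have hα := fun c : E₂ =>
    (hinv.mul (hda.hasFDerivAt.clm_apply (hasFDerivAt_const c y.2))).comp y hsnd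
  have hΓ := (hasFDerivAt_apply_apply (differentiableAt_christoffel hB hBi) v.1 w.1).comp y hfst
  have hb := ((hasFDerivAt_apply_apply (hB.differentiableAt (by norm_num)) v.1 w.1).comp y
    hfst).const_mul (-(1 / 2) : ℝ)
  have hgr : DifferentiableAt ℝ (gradient a) y.2 :=
    (InnerProductSpace.toDual ℝ E₂).symm.toContinuousLinearEquiv.differentiableAt.comp y.2 hda
  have h2 := (((hΓ.add ((hα v.2).smul_const w.1)).add ((hα w.2).smul_const v.1)).prodMk
    (hb.smul (hgr.hasFDerivAt.comp y hsnd))).congr_of_eventuallyEq hev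
  have h3 := congrArg (fun L => L z) (h1.unique h2)
  simp only [ContinuousLinearMap.flip_apply] at h3
  rw [h3]
  ext1
  · simp
    congr 3 <;> ring
  · simp

/-- Only the diagonal blocks of the curvature endomorphism enter the trace. The `E₁` block is the
curvature of `B` plus a multiple of the identity plus a rank-one map; the `E₂` block is a multiple
of `D(∇a)` plus a rank-one map. Each rank-one map has trace `|∇a|² B(v, w) / (4a)`, which turns the
factor `dim E₁` from the identity into `dim E₁ - 2`. -/
theorem ricci_warped (hB : ContDiffAt ℝ 2 B y.1)
    (hB' : ∀ᶠ x in 𝓝 y.1, ∀ v, v ≠ 0 → 0 < B x v v)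
    (hs : ∀ᶠ x in 𝓝 y.1, ∀ v w, B x v w = B x w v) (ha : ContDiffAt ℝ 2 a y.2) (ha' : 0 < a y.2)
    (v w : E₁ × E₂) :
    ricci (warped B a) y v w
      = ricci B y.1 v.1 w.1
        - Module.finrank ℝ E₁ * ((2 * a y.2)⁻¹ * fderiv ℝ (fderiv ℝ a) y.2 v.2 w.2
            - (4 * a y.2 ^ 2)⁻¹ * fderiv ℝ a y.2 v.2 * fderiv ℝ a y.2 w.2)
        - ((Module.finrank ℝ E₁ - 2) * (4 * a y.2)⁻¹ * ‖gradient a y.2‖ ^ 2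
            + 1 / 2 * LinearMap.trace ℝ E₂ (fderiv ℝ (gradient a) y.2)) * B y.1 v.1 w.1 := by
  have hΓ := christoffel_warped hB hB'.self_of_nhds ha ha'
  have hdΓ := fderiv_christoffel_warped hB hB' ha ha'
  have hsΓ := christoffel_symm (hB.differentiableAt (by norm_num)) hs
  have hB0 := hs.self_of_nhds
  have hn : fderiv ℝ a y.2 (gradient a y.2) = ‖gradient a y.2‖ ^ 2 := by
    rw [← real_inner_self_eq_norm_sq]
    conv_rhs => rw [gradient, InnerProductSpace.toDual_symm_apply]
    rfl
  set r := ‖gradient a y.2‖ ^ 2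
  have h1 : LinearMap.fst ℝ E₁ E₂ ∘ₗ (curvature (warped B a) y v w : E₁ × E₂ →ₗ[ℝ] E₁ × E₂)
        ∘ₗ LinearMap.inl ℝ E₁ E₂
      = (curvature B y.1 v.1 w.1 : E₁ →ₗ[ℝ] E₁)
        + (-((2 * a y.2)⁻¹ * fderiv ℝ (fderiv ℝ a) y.2 v.2 w.2
            - (4 * a y.2 ^ 2)⁻¹ * fderiv ℝ a y.2 v.2 * fderiv ℝ a y.2 w.2)
            - (4 * a y.2)⁻¹ * r * B y.1 v.1 w.1) • LinearMap.id
        + LinearMap.smulRight (B y.1 w.1 : E₁ →ₗ[ℝ] ℝ) (((4 * a y.2)⁻¹ * r) • v.1) := by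
    ext z
    simp [curvature_apply, hΓ, hdΓ, hn, hB0 w.1 z, hsΓ v.1 z, smul_smul]
    match_scalars <;> field_simp <;> ring_nf
  have h2 : LinearMap.snd ℝ E₁ E₂ ∘ₗ (curvature (warped B a) y v w : E₁ × E₂ →ₗ[ℝ] E₁ × E₂)
        ∘ₗ LinearMap.inr ℝ E₁ E₂
      = (-(1 / 2) * B y.1 v.1 w.1) • (fderiv ℝ (gradient a) y.2 : E₂ →ₗ[ℝ] E₂)
        + LinearMap.smulRight (fderiv ℝ a y.2 : E₂ →ₗ[ℝ] ℝ)
          (((4 * a y.2)⁻¹ * B y.1 v.1 w.1) • gradient a y.2) := by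
    ext z
    simp [curvature_apply, hΓ, hdΓ, smul_smul]
    match_scalars
    field_simp
    ring_nf
  rw [ricci, LinearMap.trace_eq_add_trace_prod, h1, h2]
  simp only [map_add, map_smul, LinearMap.trace_smulRight, LinearMap.trace_id, ricci,
    ContinuousLinearMap.coe_coe, smul_eq_mul, hn, hB0 w.1 v.1]
  ring

/-- As `f` depends on `E₂` only, it sees just the `E₂` component `-(1/2) B(v, w) ∇a` of the
Christoffel symbol. -/
theorem hessian_warped {f : E₂ → ℝ} (hB : ContDiffAt ℝ 2 B y.1)
    (hB' : ∀ v, v ≠ 0 → 0 < B y.1 v v) (ha : ContDiffAt ℝ 2 a y.2) (ha' : 0 < a y.2)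
    (hf : ContDiffAt ℝ 2 f y.2) (v w : E₁ × E₂) :
    hessian (warped B a) (fun x => f x.2) y v w
      = fderiv ℝ (fderiv ℝ f) y.2 v.2 w.2
        + 1 / 2 * B y.1 v.1 w.1 * fderiv ℝ f y.2 (gradient a y.2) := by
  have hsnd := hasFDerivAt_snd (𝕜 := ℝ) (p := y)
  have h1 : fderiv ℝ (fun x : E₁ × E₂ => f x.2) =ᶠ[𝓝 y]
      fun x => (fderiv ℝ f x.2).comp (ContinuousLinearMap.snd ℝ E₁ E₂) := by
    have hg : Filter.Tendsto Prod.snd (𝓝 y) (𝓝 y.2) := continuous_snd.continuousAt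
    filter_upwards [hg.eventually (hf.eventually (by norm_num))] with x hx
    exact ((hx.differentiableAt (by norm_num)).hasFDerivAt.comp x hasFDerivAt_snd).fderiv
  have hdf : DifferentiableAt ℝ (fderiv ℝ f) y.2 :=
    (hf.fderiv_right (m := 1) (by norm_num)).differentiableAt (by norm_num)
  have h2 := ((hdf.hasFDerivAt.comp y hsnd).clm_comp
    (hasFDerivAt_const (ContinuousLinearMap.snd ℝ E₁ E₂) y)).congr_of_eventuallyEq h1
  rw [hessian, h2.fderiv, h1.self_of_nhds, christoffel_warped hB hB' ha ha']
  simp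

end LocalGeometry

/-! ### Bilinear fields in charts -/

namespace BilinearField

variable {E H M : Type*} [NormedAddCommGroup E] [NormedSpace ℝ E] [TopologicalSpace H]
  {I : ModelWithCorners ℝ E H} [TopologicalSpace M] [ChartedSpace H M]

theorem inChart_apply (g : BilinearField I M) (q : M) (y v w : E) :
    g.inChart q y v w = g ((extChartAt I q).symm y)
      (mfderiv 𝓘(ℝ, E) I (extChartAt I q).symm y v)
      (mfderiv 𝓘(ℝ, E) I (extChartAt I q).symm y w) := rfl

theorem inChart_apply_mfderiv [I.Boundaryless] [IsManifold I 1 M] (g : BilinearField I M) (q : M)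
    (v w : TangentSpace I q) :
    g.inChart q (extChartAt I q q) (mfderiv I 𝓘(ℝ, E) (extChartAt I q) q v)
      (mfderiv I 𝓘(ℝ, E) (extChartAt I q) q w) = g q v w := by
  have h1 := mfderivWithin_extChartAt_symm_comp_mfderiv_extChartAt'
    (mem_extChartAt_source (I := I) q)
  rw [I.range_eq_univ, mfderivWithin_univ] at h1
  have h2 : ∀ v : TangentSpace I q, mfderiv 𝓘(ℝ, E) I (extChartAt I q).symm (extChartAt I q q)
      (mfderiv I 𝓘(ℝ, E) (extChartAt I q) q v) = v := fun v => congrArg (fun L => L v) h1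
  -- The chart followed by its inverse returns a point that is only propositionally `q`, so the two
  -- forms are compared on the model space `E`.
  have h3 : ∀ p, p = q → ∀ v w : E,
      (g p : E →L[ℝ] E →L[ℝ] ℝ) v w = (g q : E →L[ℝ] E →L[ℝ] ℝ) v w := by
    rintro p rfl v w
    rfl
  refine (h3 _ (extChartAt_to_inv q) _ _).trans ?_
  exact congrArg₂ (fun a b => g q a b) (h2 v) (h2 w)

theorem inChart_pos [I.Boundaryless] [IsManifold I 1 M] {g : BilinearField I M}
    (hg : ∀ p v, v ≠ 0 → 0 < g p v v) (q : M) {y : E} (hy : y ∈ (extChartAt I q).target) (v : E)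
    (hv : v ≠ 0) : 0 < g.inChart q y v v := by
  have h1 := isInvertible_mfderivWithin_extChartAt_symm (I := I) hy
  rw [I.range_eq_univ, mfderivWithin_univ] at h1
  exact hg _ _ fun h => hv (h1.injective (h.trans (map_zero _).symm))

/-- Smoothness of the metric is smoothness in the tangent bundle trivialization at `q`. The inverse
of this trivialization is the derivative of the inverse chart, so the coordinate expression is
`inChart` near the image of `q`. -/
theorem contDiffAt_inChart [I.Boundaryless] [IsManifold I 1 M] [IsManifold I ∞ M]
    (g : Bundle.ContMDiffRiemannianMetric I ∞ E (fun p : M => TangentSpace I p)) (q : M) :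
    ContDiffAt ℝ ∞ (BilinearField.inChart (I := I) g.inner q) (extChartAt I q q) := by
  have h1 := (contMDiffAt_iff.1 ((contMDiffAt_hom_bundle _).1 (g.contMDiff q)).2).2
  rw [I.range_eq_univ, contDiffWithinAt_univ] at h1
  refine h1.congr_of_eventuallyEq ?_
  filter_upwards [(isOpen_extChartAt_target q).mem_nhds
    (mem_extChartAt_target (I := I) q)] with y hy
  have hx := (extChartAt I q).map_target hy
  rw [extChartAt_source] at hx
  have h2 := TangentBundle.symmL_trivializationAt (I := I) hx
  rw [I.range_eq_univ, mfderivWithin_univ, (extChartAt I q).right_inv hy] at h2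
  ext v w
  rw [inChart_apply]
  have h3 : ∀ v : E, mfderiv 𝓘(ℝ, E) I (extChartAt I q).symm y v =
    Bundle.Trivialization.symmL ℝ (trivializationAt E (TangentSpace I) q)
      ((extChartAt I q).symm y) v :=
    fun v => congrArg (fun L => L v) h2.symm
  simp only [extChartAt_model_space_eq_id, PartialEquiv.refl_coe, Function.comp_apply, id]
  rw [inCoordinates_apply_eq₂ hx hx (Set.mem_univ _)]
  have h4 : ∀ v : E, Bundle.Trivialization.symmL ℝ (trivializationAt E (TangentSpace I) q)
      ((extChartAt I q).symm y) v
      = (trivializationAt E (TangentSpace I) q).symm ((extChartAt I q).symm y) v :=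
    fun v => Bundle.Trivialization.symmL_apply _ hx v
  rw [h3, h3, h4, h4]
  simp

end BilinearField

/-! ### The product `N × ℝᵐ` in charts -/

namespace ProductShrinker

variable {ℓ : ℕ} {N : Type*} [TopologicalSpace N] [ChartedSpace (EuclideanSpace ℝ (Fin ℓ)) N]
  {m : ℕ}

theorem factorTensor_apply (g₁ : BilinearField (𝓡 ℓ) N) (q : N × EuclideanSpace ℝ (Fin m))
    (v w : TangentSpace ((𝓡 ℓ).prod (𝓡 m)) q) :
    factorTensor g₁ m q v w = g₁ q.1 v.1 w.1 := by
  rw [factorTensor, mfderiv_fst]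
  rfl

theorem mvfderiv_snd (q : N × EuclideanSpace ℝ (Fin m)) (v : TangentSpace ((𝓡 ℓ).prod (𝓡 m)) q) :
    mvfderiv ((𝓡 ℓ).prod (𝓡 m)) (fun q' : N × EuclideanSpace ℝ (Fin m) => q'.2) q v = v.2 := by
  rw [mvfderiv]
  have := mfderiv_snd (I := 𝓡 ℓ) (I' := 𝓡 m) (x := q)
  exact congrArg (fun L => L v) this

theorem mvfderiv_comp_snd {u : EuclideanSpace ℝ (Fin m) → ℝ}
    (q : N × EuclideanSpace ℝ (Fin m)) (hu : DifferentiableAt ℝ u q.2)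
    (v : TangentSpace ((𝓡 ℓ).prod (𝓡 m)) q) :
    mvfderiv ((𝓡 ℓ).prod (𝓡 m)) (fun q' : N × EuclideanSpace ℝ (Fin m) => u q'.2) q v
      = fderiv ℝ u q.2 v.2 := by
  have h := (hu.mdifferentiableAt.hasMFDerivAt.comp q
    (hasMFDerivAt_snd (I := 𝓡 ℓ) (I' := 𝓡 m) q)).mfderiv
  rw [mfderiv_eq_fderiv] at h
  exact congrArg (fun L => L v) h

theorem euclideanTensor_apply (q : N × EuclideanSpace ℝ (Fin m))
    (v w : TangentSpace ((𝓡 ℓ).prod (𝓡 m)) q) :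
    euclideanTensor N m q v w
      = inner ℝ (v.2 : EuclideanSpace ℝ (Fin m)) (w.2 : EuclideanSpace ℝ (Fin m)) := by
  rw [euclideanTensor, bilinearPullback_apply, mvfderiv_snd, mvfderiv_snd]
  rfl

theorem mfderiv_extChartAt_prod [IsManifold (𝓡 ℓ) 1 N] (q : N × EuclideanSpace ℝ (Fin m))
    (v : TangentSpace ((𝓡 ℓ).prod (𝓡 m)) q) :
    mfderiv ((𝓡 ℓ).prod (𝓡 m)) 𝓘(ℝ, EuclideanSpace ℝ (Fin ℓ) × EuclideanSpace ℝ (Fin m))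
        (extChartAt ((𝓡 ℓ).prod (𝓡 m)) q) q v
      = (mfderiv (𝓡 ℓ) 𝓘(ℝ, EuclideanSpace ℝ (Fin ℓ)) (extChartAt (𝓡 ℓ) q.1) q.1 v.1, v.2) := by
  have hd : MDifferentiableAt ((𝓡 ℓ).prod (𝓡 m))
      𝓘(ℝ, EuclideanSpace ℝ (Fin ℓ) × EuclideanSpace ℝ (Fin m))
      (extChartAt ((𝓡 ℓ).prod (𝓡 m)) q) q :=
    mdifferentiableAt_extChartAt (mem_chart_source _ q)
  have h1 := (hasFDerivAt_fst (𝕜 := ℝ)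
    (p := extChartAt ((𝓡 ℓ).prod (𝓡 m)) q q)).hasMFDerivAt.comp q hd.hasMFDerivAt
  have h2 := (hasFDerivAt_snd (𝕜 := ℝ)
    (p := extChartAt ((𝓡 ℓ).prod (𝓡 m)) q q)).hasMFDerivAt.comp q hd.hasMFDerivAt
  have h3 := (mdifferentiableAt_extChartAt (I := 𝓡 ℓ) (mem_chart_source _ q.1)).hasMFDerivAt.comp q
    (hasMFDerivAt_fst (I := 𝓡 ℓ) (I' := 𝓡 m) q)
  have h4 := hasMFDerivAt_snd (I := 𝓡 ℓ) (I' := 𝓡 m) q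
  refine Prod.ext ?_ ?_
  · exact congrArg (fun L => L v) (hasMFDerivAt_unique h1 h3)
  · exact congrArg (fun L => L v) (hasMFDerivAt_unique h2 h4)

theorem mfderiv_extChartAt_prod_symm [IsManifold (𝓡 ℓ) 1 N] (q : N × EuclideanSpace ℝ (Fin m))
    {y : EuclideanSpace ℝ (Fin ℓ) × EuclideanSpace ℝ (Fin m)}
    (hy : y.1 ∈ (extChartAt (𝓡 ℓ) q.1).target)
    (v : EuclideanSpace ℝ (Fin ℓ) × EuclideanSpace ℝ (Fin m)) :
    mfderiv 𝓘(ℝ, EuclideanSpace ℝ (Fin ℓ) × EuclideanSpace ℝ (Fin m)) ((𝓡 ℓ).prod (𝓡 m))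
        (extChartAt ((𝓡 ℓ).prod (𝓡 m)) q).symm y v
      = (mfderiv 𝓘(ℝ, EuclideanSpace ℝ (Fin ℓ)) (𝓡 ℓ) (extChartAt (𝓡 ℓ) q.1).symm y.1 v.1,
          v.2) := by
  have hy' : y ∈ (extChartAt ((𝓡 ℓ).prod (𝓡 m)) q).target := by
    rw [extChartAt_prod]
    exact ⟨hy, by rw [extChartAt_model_space_eq_id]; exact Set.mem_univ y.2⟩
  have hd := mdifferentiableWithinAt_extChartAt_symm (I := (𝓡 ℓ).prod (𝓡 m)) hy'
  have hd1 := mdifferentiableWithinAt_extChartAt_symm (I := 𝓡 ℓ) hy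
  rw [ModelWithCorners.range_eq_univ, mdifferentiableWithinAt_univ] at hd hd1
  have h1 := (hasMFDerivAt_fst (I := 𝓡 ℓ) (I' := 𝓡 m) _).comp y hd.hasMFDerivAt
  have h2 := (hasMFDerivAt_snd (I := 𝓡 ℓ) (I' := 𝓡 m) _).comp y hd.hasMFDerivAt
  have h3 := hd1.hasMFDerivAt.comp y (hasFDerivAt_fst (𝕜 := ℝ) (p := y)).hasMFDerivAt
  have h4 := (hasFDerivAt_snd (𝕜 := ℝ) (p := y)).hasMFDerivAt
  refine Prod.ext ?_ ?_
  · exact congrArg (fun L => L v) (hasMFDerivAt_unique h1 h3)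
  · exact congrArg (fun L => L v) (hasMFDerivAt_unique h2 h4)

/-- The product chart is the identity on `ℝᵐ`, so it changes neither `a` nor the Euclidean part.
Equality is local because a chart is meaningful only on its target. -/
theorem inChart_eq_warped [IsManifold (𝓡 ℓ) 1 N] (g₁ : BilinearField (𝓡 ℓ) N)
    {g : BilinearField ((𝓡 ℓ).prod (𝓡 m)) (N × EuclideanSpace ℝ (Fin m))}
    {a : EuclideanSpace ℝ (Fin m) → ℝ}
    (hg : ∀ q, g q = a q.2 • factorTensor g₁ m q + euclideanTensor N m q)
    (q : N × EuclideanSpace ℝ (Fin m)) :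
    g.inChart q =ᶠ[𝓝 (extChartAt ((𝓡 ℓ).prod (𝓡 m)) q q)]
      LocalGeometry.warped (g₁.inChart q.1) a := by
  filter_upwards [(isOpen_extChartAt_target (I := (𝓡 ℓ).prod (𝓡 m)) q).mem_nhds
    (mem_extChartAt_target q)] with y hy
  have hy1 : y.1 ∈ (extChartAt (𝓡 ℓ) q.1).target := by
    rw [extChartAt_prod] at hy
    exact hy.1
  refine ContinuousLinearMap.ext fun v => ContinuousLinearMap.ext fun w => ?_
  have h : ∀ v w, g ((extChartAt ((𝓡 ℓ).prod (𝓡 m)) q).symm y) v w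
      = a y.2 * g₁ ((extChartAt (𝓡 ℓ) q.1).symm y.1) v.1 w.1
        + inner ℝ (v.2 : EuclideanSpace ℝ (Fin m)) (w.2 : EuclideanSpace ℝ (Fin m)) := by
    intro v w
    rw [hg]
    refine congrArg₂ (· + ·) (congrArg₂ (· * ·) rfl ?_) (euclideanTensor_apply _ v w)
    exact factorTensor_apply g₁ _ v w
  refine (h _ _).trans ?_
  exact congrArg₂ (fun v w : EuclideanSpace ℝ (Fin ℓ) × EuclideanSpace ℝ (Fin m) =>
      a y.2 * (g₁ ((extChartAt (𝓡 ℓ) q.1).symm y.1) :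
        EuclideanSpace ℝ (Fin ℓ) →L[ℝ] EuclideanSpace ℝ (Fin ℓ) →L[ℝ] ℝ) v.1 w.1
        + inner ℝ v.2 w.2)
    (mfderiv_extChartAt_prod_symm q hy1 v) (mfderiv_extChartAt_prod_symm q hy1 w)

end ProductShrinker

/-! ### Calculus of the rational functions of `t` that make up `φ(t)` -/

theorem hasDerivAt_rational_family (u c₁ c₂ k₁ k₂ k₃ t : ℝ) (ht : 1 + t * u ≠ 0) :
    HasDerivAt (fun t : ℝ => c₁ * t + c₂ * t ^ 2 + k₁ * (t * (1 + t * u)⁻¹)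
        + k₂ * (t * (1 + t * u)⁻¹) ^ 2 + k₃ * (t ^ 2 * (1 + t * u)⁻¹))
      (c₁ + c₂ * (2 * t) + k₁ * ((1 + t * u)⁻¹) ^ 2 + k₂ * (2 * t * (1 + t * u)⁻¹ ^ 3)
        + k₃ * (2 * t * (1 + t * u)⁻¹ - t ^ 2 * u * (1 + t * u)⁻¹ ^ 2)) t := by
  have h0 := hasDerivAt_id t
  have h1 := ((h0.mul_const u).const_add 1).inv ht
  have h2 := h0.mul h1
  refine (((((h0.const_mul c₁).add ((h0.pow 2).const_mul c₂)).add (h2.const_mul k₁)).add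
    ((h2.pow 2).const_mul k₂)).add (((h0.pow 2).mul h1).const_mul k₃)).congr_deriv ?_
  simp
  field_simp
  ring

theorem contDiffAt_rational_family (u c₁ c₂ k₁ k₂ k₃ : ℝ) :
    ContDiffAt ℝ 2 (fun t : ℝ => c₁ * t + c₂ * t ^ 2 + k₁ * (t * (1 + t * u)⁻¹)
        + k₂ * (t * (1 + t * u)⁻¹) ^ 2 + k₃ * (t ^ 2 * (1 + t * u)⁻¹)) 0 := by
  have h : ContDiffAt ℝ 2 (fun t : ℝ => (1 + t * u)⁻¹) 0 :=
    ContDiffAt.inv (by fun_prop) (by simp)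
  fun_prop

/-- Twice the `t²` coefficient: `t/(1+tu) = t - u t² + ⋯`, while `(t/(1+tu))²` and `t²/(1+tu)` both
begin with `t²`. -/
theorem iteratedDeriv_two_rational_family (u c₁ c₂ k₁ k₂ k₃ : ℝ) :
    iteratedDeriv 2 (fun t : ℝ => c₁ * t + c₂ * t ^ 2 + k₁ * (t * (1 + t * u)⁻¹)
        + k₂ * (t * (1 + t * u)⁻¹) ^ 2 + k₃ * (t ^ 2 * (1 + t * u)⁻¹)) 0
      = 2 * c₂ - 2 * u * k₁ + 2 * k₂ + 2 * k₃ := by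
  rw [iteratedDeriv_succ, iteratedDeriv_one]
  have hc : ∀ᶠ t : ℝ in 𝓝 0, 1 + t * u ≠ 0 :=
    (Continuous.continuousAt (by fun_prop)).eventually_ne (by simp)
  have hev := hc.mono fun t ht => (hasDerivAt_rational_family u c₁ c₂ k₁ k₂ k₃ t ht).deriv
  rw [Filter.EventuallyEq.deriv_eq hev]
  have h0 := hasDerivAt_id (0 : ℝ)
  have h1 := ((h0.mul_const u).const_add 1).inv (by simp)
  refine HasDerivAt.deriv (((((h0.const_mul 2).const_mul c₂).const_add c₁).add
    ((h1.pow 2).const_mul k₁)).add (((h0.const_mul 2).mul (h1.pow 3)).const_mul k₂) |>.add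
    ((((h0.const_mul 2).mul h1).sub (((h0.pow 2).mul_const u).mul (h1.pow 2))).const_mul k₃)
    |>.congr_deriv ?_)
  simp
  ring

/-! ### Closed form of `φ(t)` -/

namespace ProductShrinker

variable {ℓ m : ℕ} {N : Type*} [TopologicalSpace N]
    [ChartedSpace (EuclideanSpace ℝ (Fin ℓ)) N] [IsManifold (𝓡 ℓ) ∞ N]
    (g₁ : Bundle.ContMDiffRiemannianMetric (𝓡 ℓ) ∞ (EuclideanSpace ℝ (Fin ℓ))
      (fun p : N => TangentSpace (𝓡 ℓ) p))

theorem ricci_eq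
    (hEinstein : ∀ (p : N) (v w : TangentSpace (𝓡 ℓ) p),
      BilinearField.ricci g₁.inner p v w = (1 / 2) * g₁.inner p v w)
    {g : BilinearField ((𝓡 ℓ).prod (𝓡 m)) (N × EuclideanSpace ℝ (Fin m))}
    {a : EuclideanSpace ℝ (Fin m) → ℝ}
    (hg : ∀ q, g q = a q.2 • factorTensor g₁.inner m q + euclideanTensor N m q)
    (q : N × EuclideanSpace ℝ (Fin m)) (ha : ContDiffAt ℝ 2 a q.2) (ha' : 0 < a q.2)
    (v w : TangentSpace ((𝓡 ℓ).prod (𝓡 m)) q) :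
    BilinearField.ricci g q v w
      = 1 / 2 * g₁.inner q.1 v.1 w.1
        - ℓ * ((2 * a q.2)⁻¹ * fderiv ℝ (fderiv ℝ a) q.2 v.2 w.2
            - (4 * a q.2 ^ 2)⁻¹ * fderiv ℝ a q.2 v.2 * fderiv ℝ a q.2 w.2)
        - ((ℓ - 2) * (4 * a q.2)⁻¹ * ‖gradient a q.2‖ ^ 2
            + 1 / 2 * LinearMap.trace ℝ (EuclideanSpace ℝ (Fin m)) (fderiv ℝ (gradient a) q.2))
          * g₁.inner q.1 v.1 w.1 := by
  have hB := (BilinearField.contDiffAt_inChart g₁ q.1).of_le (m := 2) ENat.LEInfty.out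
  have hT := (isOpen_extChartAt_target (I := 𝓡 ℓ) q.1).mem_nhds (mem_extChartAt_target q.1)
  have hc : BilinearField.ricci g q v w = LocalGeometry.ricci (g.inChart q)
      (extChartAt ((𝓡 ℓ).prod (𝓡 m)) q q)
      (mfderiv (𝓡 ℓ) 𝓘(ℝ, EuclideanSpace ℝ (Fin ℓ)) (extChartAt (𝓡 ℓ) q.1) q.1 v.1, v.2)
      (mfderiv (𝓡 ℓ) 𝓘(ℝ, EuclideanSpace ℝ (Fin ℓ)) (extChartAt (𝓡 ℓ) q.1) q.1 w.1, w.2) :=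
    congrArg₂ (fun V W : EuclideanSpace ℝ (Fin ℓ) × EuclideanSpace ℝ (Fin m) =>
      LocalGeometry.ricci (g.inChart q) (extChartAt ((𝓡 ℓ).prod (𝓡 m)) q q) V W)
      (mfderiv_extChartAt_prod q v) (mfderiv_extChartAt_prod q w)
  rw [hc, LocalGeometry.ricci_congr (inChart_eq_warped _ hg q)]
  refine (LocalGeometry.ricci_warped (y := extChartAt ((𝓡 ℓ).prod (𝓡 m)) q q) hB
    (Filter.mem_of_superset hT fun y hy => BilinearField.inChart_pos g₁.pos q.1 hy)
    (Filter.Eventually.of_forall fun y v w => g₁.symm _ _ _) ha ha' _ _).trans ?_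
  have hb := BilinearField.inChart_apply_mfderiv (I := 𝓡 ℓ) g₁.inner q.1 v.1 w.1
  have hE := hEinstein q.1 v.1 w.1
  rw [finrank_euclideanSpace_fin]
  exact congrArg₂ (fun r b : ℝ => r
        - ℓ * ((2 * a q.2)⁻¹ * fderiv ℝ (fderiv ℝ a) q.2 v.2 w.2
            - (4 * a q.2 ^ 2)⁻¹ * fderiv ℝ a q.2 v.2 * fderiv ℝ a q.2 w.2)
        - ((ℓ - 2) * (4 * a q.2)⁻¹ * ‖gradient a q.2‖ ^ 2
            + 1 / 2 * LinearMap.trace ℝ (EuclideanSpace ℝ (Fin m)) (fderiv ℝ (gradient a) q.2))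
          * b) hE hb

theorem hessian_eq {g : BilinearField ((𝓡 ℓ).prod (𝓡 m)) (N × EuclideanSpace ℝ (Fin m))}
    {a f : EuclideanSpace ℝ (Fin m) → ℝ}
    (hg : ∀ q, g q = a q.2 • factorTensor g₁.inner m q + euclideanTensor N m q)
    (q : N × EuclideanSpace ℝ (Fin m)) (ha : ContDiffAt ℝ 2 a q.2) (ha' : 0 < a q.2)
    (hf : ContDiffAt ℝ 2 f q.2) (v w : TangentSpace ((𝓡 ℓ).prod (𝓡 m)) q) :
    BilinearField.hessian g (fun q' => f q'.2) q v w
      = fderiv ℝ (fderiv ℝ f) q.2 v.2 w.2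
        + 1 / 2 * g₁.inner q.1 v.1 w.1 * fderiv ℝ f q.2 (gradient a q.2) := by
  have hB := (BilinearField.contDiffAt_inChart g₁ q.1).of_le (m := 2) ENat.LEInfty.out
  have hc : BilinearField.hessian g (fun q' => f q'.2) q v w = LocalGeometry.hessian (g.inChart q)
      (fun y => f y.2) (extChartAt ((𝓡 ℓ).prod (𝓡 m)) q q)
      (mfderiv (𝓡 ℓ) 𝓘(ℝ, EuclideanSpace ℝ (Fin ℓ)) (extChartAt (𝓡 ℓ) q.1) q.1 v.1, v.2)
      (mfderiv (𝓡 ℓ) 𝓘(ℝ, EuclideanSpace ℝ (Fin ℓ)) (extChartAt (𝓡 ℓ) q.1) q.1 w.1, w.2) :=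
    congrArg₂ (fun V W : EuclideanSpace ℝ (Fin ℓ) × EuclideanSpace ℝ (Fin m) =>
      LocalGeometry.hessian (g.inChart q) (fun y => f y.2)
        (extChartAt ((𝓡 ℓ).prod (𝓡 m)) q q) V W)
      (mfderiv_extChartAt_prod q v) (mfderiv_extChartAt_prod q w)
  rw [hc, LocalGeometry.hessian_congr (inChart_eq_warped _ hg q) Filter.EventuallyEq.rfl]
  refine (LocalGeometry.hessian_warped (y := extChartAt ((𝓡 ℓ).prod (𝓡 m)) q q) hB
    (BilinearField.inChart_pos g₁.pos q.1 (mem_extChartAt_target q.1)) ha ha' hf _ _).trans ?_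
  exact congrArg (fun b : ℝ => fderiv ℝ (fderiv ℝ f) q.2 v.2 w.2
      + 1 / 2 * b * fderiv ℝ f q.2 (gradient a q.2))
    (BilinearField.inChart_apply_mfderiv (I := 𝓡 ℓ) g₁.inner q.1 v.1 w.1)

/-- The first coefficient, the only one involving `x` and the Laplacian of `u`, multiplies `t` alone
and so drops out of the second derivative. The `t²` term is the pairing of `t dk` with `∇a = t ∇u`
in the Hessian; the last three terms come from the Ricci curvature. -/
theorem phi_eq
    (hEinstein : ∀ (p : N) (v w : TangentSpace (𝓡 ℓ) p),
      BilinearField.ricci g₁.inner p v w = (1 / 2) * g₁.inner p v w)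
    {u : EuclideanSpace ℝ (Fin m) → ℝ} (hu : ContDiff ℝ 2 u)
    {h : BilinearField ((𝓡 ℓ).prod (𝓡 m)) (N × EuclideanSpace ℝ (Fin m))}
    (hh : ∀ q, h q = u q.2 • factorTensor g₁.inner m q)
    {k : N × EuclideanSpace ℝ (Fin m) → ℝ} (hk : ∀ q, k q = (ℓ : ℝ) / 2 * u q.2)
    (q : N × EuclideanSpace ℝ (Fin m)) (v w : TangentSpace ((𝓡 ℓ).prod (𝓡 m)) q)
    {t : ℝ} (ht : 0 < 1 + t * u q.2) :
    phi g₁.inner h k t q v w =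
      (u q.2 / 2 * g₁.inner q.1 v.1 w.1
        + 1 / 2 * LinearMap.trace ℝ (EuclideanSpace ℝ (Fin m)) (fderiv ℝ (gradient u) q.2)
          * g₁.inner q.1 v.1 w.1
        - ℓ / 2 * fderiv ℝ (fderiv ℝ u) q.2 v.2 w.2
        - 1 / 4 * g₁.inner q.1 v.1 w.1 * inner ℝ q.2 (gradient u q.2)) * t
      + (-(ℓ / 4 * ‖gradient u q.2‖ ^ 2 * g₁.inner q.1 v.1 w.1)) * t ^ 2
      + (ℓ / 2 * fderiv ℝ (fderiv ℝ u) q.2 v.2 w.2) * (t * (1 + t * u q.2)⁻¹)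
      + (-(ℓ / 4 * fderiv ℝ u q.2 v.2 * fderiv ℝ u q.2 w.2)) * (t * (1 + t * u q.2)⁻¹) ^ 2
      + ((ℓ - 2) / 4 * ‖gradient u q.2‖ ^ 2 * g₁.inner q.1 v.1 w.1)
        * (t ^ 2 * (1 + t * u q.2)⁻¹) := by
  have hg : ∀ q, (metric g₁.inner m + t • h) q
      = (1 + t * u q.2) • factorTensor g₁.inner m q + euclideanTensor N m q := by
    intro q
    rw [Pi.add_apply, Pi.smul_apply, hh, metric, Pi.add_apply]
    module
  have hf : (potential ℓ N m + t • k)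
      = fun q' => (‖q'.2‖ ^ 2 / 4 + (ℓ : ℝ) / 2) + t * ((ℓ : ℝ) / 2 * u q'.2) := by
    funext q'
    rw [Pi.add_apply, Pi.smul_apply, hk, potential, smul_eq_mul]
  have hud := hu.differentiable (by norm_num)
  have hudd : Differentiable ℝ (fderiv ℝ u) :=
    (hu.fderiv_right (m := 1) (by norm_num)).differentiable (by norm_num)
  have hgd : Differentiable ℝ (gradient u) :=
    (InnerProductSpace.toDual ℝ _).symm.toContinuousLinearEquiv.differentiable.comp hudd
  have ha1 : fderiv ℝ (fun x => 1 + t * u x) = fun x => t • fderiv ℝ u x :=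
    funext fun x => (((hud x).hasFDerivAt.const_mul t).const_add 1).fderiv
  have ha2 : fderiv ℝ (fderiv ℝ (fun x => 1 + t * u x)) q.2 = t • fderiv ℝ (fderiv ℝ u) q.2 := by
    rw [ha1]
    exact ((hudd q.2).hasFDerivAt.const_smul t).fderiv
  have ha3 : gradient (fun x => 1 + t * u x) = fun x => t • gradient u x := by
    funext x
    rw [gradient, ha1, map_smul, gradient]
  have ha4 : fderiv ℝ (gradient (fun x => 1 + t * u x)) q.2 = t • fderiv ℝ (gradient u) q.2 := by
    rw [ha3]
    exact ((hgd q.2).hasFDerivAt.const_smul t).fderiv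
  -- Over `ℝ` the conjugate-linear slot of `innerSL` is linear; `J` is the inner product as a
  -- bilinear map, so that `x ↦ J x` is its own derivative.
  obtain ⟨J, hJ⟩ : ∃ J : EuclideanSpace ℝ (Fin m) →L[ℝ] EuclideanSpace ℝ (Fin m) →L[ℝ] ℝ,
      ∀ x z, J x z = inner ℝ x z := ⟨innerSL ℝ, fun _ _ => rfl⟩
  have hf1 : fderiv ℝ (fun x : EuclideanSpace ℝ (Fin m) =>
      (‖x‖ ^ 2 / 4 + (ℓ : ℝ) / 2) + t * ((ℓ : ℝ) / 2 * u x))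
      = fun x => (1 / 2 : ℝ) • J x + (t * (ℓ / 2)) • fderiv ℝ u x := by
    funext x
    have h1 := (((hasStrictFDerivAt_norm_sq x).hasFDerivAt.mul_const (4⁻¹ : ℝ)).add_const
      ((ℓ : ℝ) / 2)).add (((hud x).hasFDerivAt.const_mul ((ℓ : ℝ) / 2)).const_mul t)
    refine (h1.congr_fderiv ?_).fderiv
    ext z
    simp [hJ]
    ring
  have hf2 : fderiv ℝ (fderiv ℝ (fun x : EuclideanSpace ℝ (Fin m) =>
      (‖x‖ ^ 2 / 4 + (ℓ : ℝ) / 2) + t * ((ℓ : ℝ) / 2 * u x))) q.2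
      = (1 / 2 : ℝ) • J + (t * (ℓ / 2)) • fderiv ℝ (fderiv ℝ u) q.2 := by
    rw [hf1]
    exact ((J.hasFDerivAt.const_smul (1 / 2 : ℝ)).add
      ((hudd q.2).hasFDerivAt.const_smul (t * (ℓ / 2) : ℝ))).fderiv
  have hn : fderiv ℝ u q.2 (gradient u q.2) = ‖gradient u q.2‖ ^ 2 := by
    rw [← real_inner_self_eq_norm_sq]
    conv_rhs => rw [gradient, InnerProductSpace.toDual_symm_apply]
    rfl
  have hac : ContDiffAt ℝ 2 (fun x => 1 + t * u x) q.2 := by fun_prop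
  have hfc : ContDiffAt ℝ 2 (fun x : EuclideanSpace ℝ (Fin m) =>
      (‖x‖ ^ 2 / 4 + (ℓ : ℝ) / 2) + t * ((ℓ : ℝ) / 2 * u x)) q.2 := by
    have := contDiff_norm_sq ℝ (E := EuclideanSpace ℝ (Fin m)) (n := 2)
    fun_prop
  have hm : (metric g₁.inner m + t • h) q v w
      = (1 + t * u q.2) * g₁.inner q.1 v.1 w.1
        + inner ℝ (v.2 : EuclideanSpace ℝ (Fin m)) (w.2 : EuclideanSpace ℝ (Fin m)) := by
    rw [hg]
    exact congrArg₂ (· + ·) (congrArg₂ (· * ·) rfl (factorTensor_apply g₁.inner q v w))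
      (euclideanTensor_apply q v w)
  rw [phi, BilinearField.shrinkerDefect, hm, hf, ricci_eq g₁ hEinstein hg q hac ht,
    hessian_eq g₁ hg q hac ht hfc, ha2, ha4, ha3, ha1, hf2, hf1]
  simp only [map_smul, smul_apply, add_apply, smul_eq_mul, norm_smul, hn,
    ContinuousLinearMap.toLinearMap_smul, hJ, mul_pow, Real.norm_eq_abs, sq_abs]
  field_simp
  ring

end ProductShrinker

/-! ### The second variation -/

theorem proposition5 (ℓ m : ℕ) {N : Type*} [TopologicalSpace N]
    [ChartedSpace (EuclideanSpace ℝ (Fin ℓ)) N] [IsManifold (𝓡 ℓ) ∞ N]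
    (g₁ : Bundle.ContMDiffRiemannianMetric (𝓡 ℓ) ∞ (EuclideanSpace ℝ (Fin ℓ))
      (fun p : N => TangentSpace (𝓡 ℓ) p))
    (hEinstein : ∀ (p : N) (v w : TangentSpace (𝓡 ℓ) p),
      BilinearField.ricci g₁.inner p v w = (1 / 2) * g₁.inner p v w)
    (u : EuclideanSpace ℝ (Fin m) → ℝ) (hu : ContDiff ℝ 2 u)
    (h : BilinearField ((𝓡 ℓ).prod (𝓡 m)) (N × EuclideanSpace ℝ (Fin m)))
    (hh : ∀ q, h q = u q.2 • ProductShrinker.factorTensor g₁.inner m q)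
    (k : N × EuclideanSpace ℝ (Fin m) → ℝ) (hk : ∀ q, k q = (ℓ : ℝ) / 2 * u q.2)
    (q : N × EuclideanSpace ℝ (Fin m)) (v w : TangentSpace ((𝓡 ℓ).prod (𝓡 m)) q) :
    ContDiffAt ℝ 2 (fun t : ℝ => ProductShrinker.phi g₁.inner h k t q v w) 0 ∧
    2 * iteratedDeriv 2 (fun t : ℝ => ProductShrinker.phi g₁.inner h k t q v w) 0
      = -2 * ‖gradient u q.2‖ ^ 2 * ProductShrinker.factorTensor g₁.inner m q v w
        - 2 * (ℓ : ℝ) * u q.2 * BilinearField.hessian (ProductShrinker.metric g₁.inner m)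
            (fun q' => u q'.2) q v w
        - (ℓ : ℝ) * (mvfderiv ((𝓡 ℓ).prod (𝓡 m))
              (fun q' : N × EuclideanSpace ℝ (Fin m) => u q'.2) q v)
            * (mvfderiv ((𝓡 ℓ).prod (𝓡 m))
              (fun q' : N × EuclideanSpace ℝ (Fin m) => u q'.2) q w) := by
  have hev : (fun t : ℝ => ProductShrinker.phi g₁.inner h k t q v w) =ᶠ[𝓝 0] _ :=
    ((Continuous.continuousAt (by fun_prop : Continuous fun t : ℝ => 1 + t * u q.2)
      ).eventually_const_lt (by simp)).mono fun t ht => ProductShrinker.phi_eq g₁ hEinstein hu hh hk q v w ht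
  refine ⟨(contDiffAt_rational_family _ _ _ _ _ _).congr_of_eventuallyEq hev, ?_⟩
  -- The undeformed metric is the case `a = 1`, where `∇a = 0` and the Hessian of `u` reduces to the
  -- Euclidean one.
  have hH := ProductShrinker.hessian_eq (a := fun _ => 1) g₁
    (g := ProductShrinker.metric g₁.inner m) (fun q => by rw [one_smul]; rfl) q
    contDiffAt_const one_pos hu.contDiffAt v w
  have hG : gradient (fun _ : EuclideanSpace ℝ (Fin m) => (1 : ℝ)) q.2 = 0 := by
    rw [gradient, fderiv_const_apply, map_zero]
  have hd := hu.differentiable (by norm_num) q.2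
  rw [hev.iteratedDeriv_eq, iteratedDeriv_two_rational_family, hH, hG, map_zero,
    ProductShrinker.mvfderiv_comp_snd q hd, ProductShrinker.mvfderiv_comp_snd q hd,
    ProductShrinker.factorTensor_apply g₁.inner q v w]
  ring
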